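/- Let $X_1, X_2, \dots$ be an exchangeable sequence of real random variables on a probability space, i.e. for every $N\ge 1$ and every permutation $\tau$ of $\{1,\dots,N\}$ the vectors $(X_{\tau(1)},\dots,X_{\tau(N)})$ and $(X_1,\dots,X_N)$ have the same law. Suppose that $\mathbb{E}[X_1^2]<\infty$, $\mathbb{E}[X_1]=0$ and $\mathbb{E}[X_1X_2]=0$. Let $\mathfrak{F}$ be the set of distribution functions on $\mathbb{R}$ (monotone, right continuous, with limits $0$ at $-\infty$ and $1$ at $+\infty$), with the $\sigma$-field generated by the sets $\{F : F(x)\le y\}$, $x,y\in\mathbb{R}$; for $F\in\mathfrak{F}$ let $X_F, X_{F,1},X_{F,2},\dots$ be i.i.d. with distribution function $F$. Call a probability measure $\mu$ on $\mathfrak{F}$ a mixing measure of $(X_i)$ if for all $n\ge1$ and all Borel sets $B\subseteq\mathbb{R}^n$ $$\mathbb{P}\big((X_1,\dots,X_n)\in B\big)=\int_{\mathfrak{F}}\mathbb{P}\big((X_{F,1},\dots,X_{F,n})\in B\big)\,d\mu(F).$$ Then $(X_i)$ has a mixing measure, and for every mixing measure $\mu_X$ of $(X_i)$ the following holds. Put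 $\mathfrak{F}_0'=\{F\in\mathfrak{F}:\mathbb{E}[X_F]=0,\ \mathbb{E}[X_F^2]<\infty\}$. The centered Gaussian mixture $$B\longmapsto\int_{\mathfrak{F}_0'}N\big(0,\mathbb{E}[X_F^2]\big)(B)\,d\mu_X(F),$$ where $N(0,0)$ is the Dirac mass at $0$, is a probability measure on $\mathbb{R}$, and, if $Z_X$ is any random variable with this law, $$S_n=\frac1{\sqrt n}\sum_{i=1}^n X_i$$ converges in distribution to $Z_X$ as $n\to\infty$. -/

import Mathlib

open MeasureTheory ProbabilityTheory Filter Topology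
open scoped ENNReal

/-- A sequence of real random variables is exchangeable if, for all `N`, permuting its first `N`
terms does not change their joint law. (`X 0, X 1, …` stand for `X₁, X₂, …`.) -/
def IsExchangeable {Ω : Type*} [MeasurableSpace Ω] (P : Measure Ω) (X : ℕ → Ω → ℝ) : Prop :=
  ∀ (N : ℕ) (τ : Equiv.Perm (Fin N)),
    P.map (fun ω (i : Fin N) => X (τ i) ω) = P.map (fun ω (i : Fin N) => X i ω)

/-- One-dimensional distribution functions: monotone, right continuous (both part of
`StieltjesFunction`), with limit `0` at `-∞` and `1` at `+∞`. -/
structure DistributionFunction extends StieltjesFunction ℝ where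
  tendsto_atBot' : Tendsto toFun atBot (𝓝 0)
  tendsto_atTop' : Tendsto toFun atTop (𝓝 1)

namespace DistributionFunction

/-- The `σ`-field generated by the sets `{F | F x ≤ y}`. -/
instance : MeasurableSpace DistributionFunction :=
  MeasurableSpace.generateFrom
    {s | ∃ x y : ℝ, s = {F : DistributionFunction | F.toStieltjesFunction x ≤ y}}

/-- The probability measure on `ℝ` with distribution function `F`, i.e. the law of `X_F`. -/
noncomputable def law (F : DistributionFunction) : Measure ℝ :=
  F.toStieltjesFunction.measure

instance (F : DistributionFunction) : IsProbabilityMeasure F.law :=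
  F.toStieltjesFunction.isProbabilityMeasure F.tendsto_atBot' F.tendsto_atTop'

/-- `E[X_F ^ 2]`, possibly infinite. -/
noncomputable def secondMoment (F : DistributionFunction) : ℝ≥0∞ :=
  ∫⁻ x, ENNReal.ofReal (x ^ 2) ∂F.law

/-- The distribution functions with `E[X_F] = 0` and `E[X_F ^ 2] < ∞`. (The second condition
makes `X_F` integrable, so the mean is a genuine one.) -/
def centered : Set DistributionFunction :=
  {F | ∫ x, x ∂F.law = 0 ∧ F.secondMoment < ∞}

theorem measurable_law : Measurable law := by
  refine .measure_of_isPiSystem_of_isProbabilityMeasure (borel_eq_generateFrom_Iic ℝ)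
    isPiSystem_Iic ?_
  rintro _ ⟨x, rfl⟩
  have h : ∀ F : DistributionFunction,
      F.law (Set.Iic x) = ENNReal.ofReal (F.toStieltjesFunction x) := fun F => by
    rw [law, StieltjesFunction.measure_Iic _ F.tendsto_atBot', sub_zero]
  simp_rw [h]
  refine Measurable.ennreal_ofReal (measurable_of_Iic fun y => ?_)
  exact MeasurableSpace.measurableSet_generateFrom ⟨x, y, rfl⟩

theorem measurable_secondMoment : Measurable secondMoment :=
  (Measure.measurable_lintegral (by fun_prop)).comp measurable_law

end DistributionFunction

/-- `μ` is a de Finetti mixing measure of the sequence `X`: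
`P((X₁, …, Xₙ) ∈ B) = ∫ P((X_{F,1}, …, X_{F,n}) ∈ B) dμ(F)` for all `n ≥ 1` and all Borel sets
`B ⊆ ℝⁿ`, where `X_{F,1}, …, X_{F,n}` are i.i.d. with distribution function `F`, so that their
joint law is a product measure. -/
def IsMixingMeasure {Ω : Type*} [MeasurableSpace Ω] (P : Measure Ω) (X : ℕ → Ω → ℝ)
    (μ : Measure DistributionFunction) : Prop :=
  ∀ n : ℕ, 0 < n → ∀ B : Set (Fin n → ℝ), MeasurableSet B →
    P {ω | (fun i : Fin n => X i ω) ∈ B} = ∫⁻ F, Measure.pi (fun _ : Fin n => F.law) B ∂μ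

/-- The centered Gaussian mixture: the measure
`B ↦ ∫ N(0, E[X_F ^ 2])(B) dμ(F)`, where `F` runs over the distribution functions with mean `0` and
finite second moment. Here `N(0, 0)` is the Dirac mass at `0`. -/
noncomputable def centeredGaussianMixture (μ : Measure DistributionFunction) : Measure ℝ :=
  (μ.restrict DistributionFunction.centered).bind
    (fun F => gaussianReal 0 F.secondMoment.toNNReal)

theorem measurable_gaussianReal_secondMoment :
    Measurable (fun F : DistributionFunction => gaussianReal 0 F.secondMoment.toNNReal) :=
  measurable_gaussianReal.comp
    (measurable_const.prodMk DistributionFunction.measurable_secondMoment.ennreal_toNNReal)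

theorem centeredGaussianMixture_apply (μ : Measure DistributionFunction) {B : Set ℝ}
    (hB : MeasurableSet B) :
    centeredGaussianMixture μ B =
      ∫⁻ F in DistributionFunction.centered, gaussianReal 0 F.secondMoment.toNNReal B ∂μ :=
  Measure.bind_apply hB measurable_gaussianReal_secondMoment.aemeasurable

/-- If `E[X_F ^ 2]` vanishes for `μ`-almost no `F`, the centered Gaussian mixture has the density
`x ↦ ∫ (2π E[X_F ^ 2])^(-1/2) exp(-x ^ 2 / (2 E[X_F ^ 2])) dμ(F)`. -/
theorem centeredGaussianMixture_eq_withDensity (μ : Measure DistributionFunction) [SFinite μ]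
    (h : ∀ᵐ F ∂μ.restrict DistributionFunction.centered, F.secondMoment.toNNReal ≠ 0) :
    centeredGaussianMixture μ = (volume : Measure ℝ).withDensity
      (fun x => ∫⁻ F in DistributionFunction.centered,
        gaussianPDF 0 F.secondMoment.toNNReal x ∂μ) := by
  ext B hB
  rw [centeredGaussianMixture_apply μ hB, withDensity_apply _ hB, lintegral_lintegral_swap]
  · refine lintegral_congr_ae (h.mono fun F hF => ?_)
    exact gaussianReal_apply 0 hF B
  · have h1 : Measurable (fun p : ℝ × DistributionFunction =>
        ((0 : ℝ), p.2.secondMoment.toNNReal, p.1)) :=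
      measurable_const.prodMk
        ((DistributionFunction.measurable_secondMoment.ennreal_toNNReal.comp measurable_snd).prodMk
          measurable_fst)
    exact (measurable_uncurry_gaussianPDF.comp h1).aemeasurable

/-!
The proof combines de Finetti's theorem with the classical central limit theorem.

*Existence of a mixing measure.* Exchangeability implies that deleting or reordering terms does not
change the law of the sequence (`IsExchangeable.map_comp_injective`). Hence one kernel `κ`, the
regular conditional law of `X 0` given `(X 1, X 2, …)`, is also the conditional law of any `X i`
given any later tail `(X n, X (n + 1), …)`. For a Borel set `A` the conditional probabilities
`κ (X n, X (n + 1), …) A` form a sequence of successive projections in `L²`, and they all have the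
same norm because the tails are equal in law; so they agree almost surely
(`IsExchangeable.directingKernel_tailSeq_succ`). Conditioning one coordinate at a time then shows
that `X 0, …, X (k - 1)` are conditionally i.i.d. with law `κ`
(`IsExchangeable.lintegral_prod_indicator_mul`), and the law of the distribution function of `κ` is
a mixing measure. No martingale limit is needed.

*Convergence.* Let `μ` be a mixing measure. The second moment of `X 0` is the `μ`-integral of
`E[X_F ^ 2]`, and `E[X 0 * X 1]` is the `μ`-integral of `E[X_F] ^ 2`; so `μ`-almost every `F` is
centered with finite variance (`IsMixingMeasure.ae_mem_centered`), and the Gaussian mixture has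
mass one. The characteristic function of `S_n` at `t` is the `μ`-integral of `φ_F (t / √n) ^ n`,
where `φ_F` is that of `X_F`. The integrand is bounded by `1` and converges by the central limit
theorem, so dominated convergence gives the characteristic function of the mixture
(`IsMixingMeasure.tendsto_charFun`), and Lévy's continuity theorem concludes.
-/

/-! ### Exchangeability of the infinite sequence -/

/-- The infinite-dimensional form of exchangeability: passing to distinct indices does not change
the law of the whole sequence. A finite window of `σ` extends to a permutation of a larger one. -/
theorem IsExchangeable.map_comp_injective {Ω : Type*} [MeasurableSpace Ω] {P : Measure Ω}
    [IsFiniteMeasure P] {X : ℕ → Ω → ℝ} (h : IsExchangeable P X) (hX : ∀ i, Measurable (X i))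
    {σ : ℕ → ℕ} (hσ : Function.Injective σ) :
    P.map (fun ω j => X (σ j) ω) = P.map (fun ω j => X j ω) := by
  have hm : ∀ s : ℕ → ℕ, AEMeasurable (fun ω j => X (s j) ω) P := fun s =>
    (measurable_pi_lambda _ fun j => hX (s j)).aemeasurable
  rw [map_eq_iff_forall_finset_map_restrict_eq (X := fun j => X (σ j)) (Y := X) (hm σ) (hm id)]
  intro I
  obtain ⟨M, hM⟩ : ∃ M : ℕ, ∀ i ∈ I ∪ I.image σ, i < M :=
    ⟨(I ∪ I.image σ).sup id + 1, fun i hi => Nat.lt_succ_of_le (Finset.le_sup (f := id) hi)⟩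
  have hI : ∀ i ∈ I, i < M := fun i hi => hM i (Finset.mem_union_left _ hi)
  have hσI : ∀ i ∈ I, σ i < M := fun i hi =>
    hM _ (Finset.mem_union_right _ (Finset.mem_image_of_mem σ hi))
  let f : Fin M → Fin M := fun i => ⟨σ i % M, Nat.mod_lt _ i.pos⟩
  obtain ⟨g, hg⟩ := Set.MapsTo.exists_equiv_extend_of_card_eq (α := Fin M) (t := Finset.univ)
    (by simp) (s := {i : Fin M | (i : ℕ) ∈ I}) (f := f) (fun i _ => by simp) (by
      intro i hi j hj hij
      have := congrArg Fin.val hij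
      simp only [f, Nat.mod_eq_of_lt (hσI _ hi), Nat.mod_eq_of_lt (hσI _ hj)] at this
      exact Fin.ext (hσ this))
  let τ : Equiv.Perm (Fin M) := g.trans (Equiv.subtypeUnivEquiv fun i => Finset.mem_univ i)
  have hτ : ∀ i : I, ((τ ⟨i, hI i i.2⟩ : Fin M) : ℕ) = σ i := fun i => by
    have := congrArg Fin.val (hg ⟨i, hI i i.2⟩ i.2)
    simpa [τ, f, Nat.mod_eq_of_lt (hσI _ i.2)] using this
  have hp : Measurable (fun (x : Fin M → ℝ) (i : I) => x ⟨i, hI i i.2⟩) := by fun_prop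
  have key := congrArg (Measure.map fun (x : Fin M → ℝ) (i : I) => x ⟨i, hI i i.2⟩) (h M τ)
  rw [Measure.map_map hp (measurable_pi_lambda _ fun i => hX _),
    Measure.map_map hp (measurable_pi_lambda _ fun i => hX _)] at key
  simp only [Function.comp_def, hτ] at key
  exact key

/-- The sequence with its first `n` terms removed. -/
def tailSeq {Ω : Type*} (X : ℕ → Ω → ℝ) (n : ℕ) (ω : Ω) : ℕ → ℝ := fun j => X (n + j) ω

section DeFinetti

variable {Ω : Type*} [MeasurableSpace Ω] {P : Measure Ω} {X : ℕ → Ω → ℝ}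

theorem measurable_tailSeq (hX : ∀ i, Measurable (X i)) (n : ℕ) : Measurable (tailSeq X n) :=
  measurable_pi_lambda _ fun j => hX (n + j)

theorem measurable_comp_shift {E : Type*} [MeasurableSpace E] {G : (ℕ → ℝ) → E}
    (hG : Measurable G) : Measurable fun y : ℕ → ℝ => G fun j => y (j + 1) :=
  hG.comp (measurable_pi_lambda _ fun j => measurable_pi_apply (j + 1))

theorem tailSeq_succ {Ω : Type*} (X : ℕ → Ω → ℝ) (n : ℕ) (ω : Ω) :
    tailSeq X (n + 1) ω = fun j => tailSeq X n ω (j + 1) := by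
  funext j
  simp only [tailSeq]
  congr 1
  omega

variable [IsProbabilityMeasure P]

theorem IsExchangeable.map_tailSeq (h : IsExchangeable P X) (hX : ∀ i, Measurable (X i)) (n : ℕ) :
    P.map (tailSeq X n) = P.map (tailSeq X 1) :=
  (h.map_comp_injective hX (add_right_injective n)).trans
    (h.map_comp_injective hX (add_right_injective 1)).symm

theorem IsExchangeable.map_tailSeq_prodMk (h : IsExchangeable P X) (hX : ∀ i, Measurable (X i))
    {i n : ℕ} (hi : i < n) :
    P.map (fun ω => (tailSeq X n ω, X i ω)) = P.map (fun ω => (tailSeq X 1 ω, X 0 ω)) := by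
  -- Both pairs are the image of a reindexed sequence `(X i, X n, X (n + 1), …)`.
  have key : ∀ i n : ℕ, i < n → P.map (fun ω => (tailSeq X n ω, X i ω)) =
      (P.map fun ω j => X j ω).map fun y : ℕ → ℝ => (fun j => y (j + 1), y 0) := by
    intro i n hi
    have hσ : Function.Injective (fun j : ℕ => Nat.casesOn j i fun k => n + k : ℕ → ℕ) := by
      rintro (_ | a) (_ | b) hab
      · rfl
      · have : i = n + b := hab
        omega
      · have : n + a = i := hab
        omega
      · have : n + a = n + b := hab
        omega
    rw [← h.map_comp_injective hX hσ,
      Measure.map_map (by fun_prop) (measurable_pi_lambda _ fun j => hX _)]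
    rfl
  rw [key i n hi, key 0 1 one_pos]

/-! ### De Finetti's theorem -/

/-- The regular conditional law of `X 0` given `(X 1, X 2, …)`: de Finetti's directing random
measure, as a function of the later terms. -/
noncomputable def directingKernel (P : Measure Ω) [IsProbabilityMeasure P] (X : ℕ → Ω → ℝ) :
    Kernel (ℕ → ℝ) ℝ :=
  condDistrib (X 0) (tailSeq X 1) P

instance : IsMarkovKernel (directingKernel P X) := by
  unfold directingKernel; infer_instance

/-- By exchangeability, the directing kernel is the conditional law of *every* `X i` given *every*
later tail. -/
theorem IsExchangeable.lintegral_indicator_mul (h : IsExchangeable P X)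
    (hX : ∀ i, Measurable (X i)) {i n : ℕ} (hi : i < n) {A : Set ℝ} (hA : MeasurableSet A)
    {H : (ℕ → ℝ) → ℝ≥0∞} (hH : Measurable H) :
    ∫⁻ ω, A.indicator 1 (X i ω) * H (tailSeq X n ω) ∂P =
      ∫⁻ ω, directingKernel P X (tailSeq X n ω) A * H (tailSeq X n ω) ∂P := by
  have hF : Measurable fun p : (ℕ → ℝ) × ℝ => A.indicator (1 : ℝ → ℝ≥0∞) p.2 * H p.1 :=
    ((measurable_one.indicator hA).comp measurable_snd).mul (hH.comp measurable_fst)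
  have hκ : Measurable fun y => directingKernel P X y A * H y :=
    (Kernel.measurable_coe _ hA).mul hH
  calc ∫⁻ ω, A.indicator 1 (X i ω) * H (tailSeq X n ω) ∂P
      = ∫⁻ p, A.indicator 1 p.2 * H p.1 ∂P.map (fun ω => (tailSeq X n ω, X i ω)) :=
        (lintegral_map hF ((measurable_tailSeq hX n).prodMk (hX i))).symm
    _ = ∫⁻ p, A.indicator 1 p.2 * H p.1 ∂(P.map (tailSeq X 1) ⊗ₘ directingKernel P X) := by
        rw [h.map_tailSeq_prodMk hX hi, directingKernel,
          compProd_map_condDistrib (hX 0).aemeasurable]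
    _ = ∫⁻ y, directingKernel P X y A * H y ∂P.map (tailSeq X 1) := by
        rw [Measure.lintegral_compProd hF]
        refine lintegral_congr fun y => ?_
        simp only
        rw [lintegral_mul_const _ (measurable_one.indicator hA), lintegral_indicator_one hA]
    _ = _ := by
        rw [← h.map_tailSeq hX n, lintegral_map hκ (measurable_tailSeq hX n)]

/-- The directing random measure does not depend on the tail it is computed from. With `g n` the
conditional probability given the `n`-th tail, `g (n + 1)` is the projection of `g n`, while both
have the same `L²` norm since the tails are equal in law. -/
theorem IsExchangeable.directingKernel_tailSeq_succ (h : IsExchangeable P X)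
    (hX : ∀ i, Measurable (X i)) {n : ℕ} (hn : 0 < n) {A : Set ℝ} (hA : MeasurableSet A) :
    (fun ω => directingKernel P X (tailSeq X n ω) A) =ᵐ[P]
      fun ω => directingKernel P X (tailSeq X (n + 1) ω) A := by
  set κ := directingKernel P X
  have hκ : Measurable fun y => κ y A := Kernel.measurable_coe _ hA
  set g : ℕ → Ω → ℝ := fun m ω => (κ (tailSeq X m ω)).real A with hg
  have hgm : ∀ m, Measurable (g m) := fun m => (hκ.comp (measurable_tailSeq hX m)).ennreal_toReal
  have hg0 : ∀ m ω, 0 ≤ g m ω := fun m ω => measureReal_nonneg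
  have hg1 : ∀ m ω, g m ω ≤ 1 := fun m ω => measureReal_le_one
  have hint : ∀ a b, Integrable (fun ω => g a ω * g b ω) P := fun a b =>
    Integrable.of_bound ((hgm a).mul (hgm b)).aestronglyMeasurable 1 <| ae_of_all _ fun ω => by
      rw [Real.norm_of_nonneg (mul_nonneg (hg0 a ω) (hg0 b ω))]
      exact mul_le_one₀ (hg1 a ω) (hg0 b ω) (hg1 b ω)
  have hl : ∀ a b, ∫ ω, g a ω * g b ω ∂P =
      (∫⁻ ω, κ (tailSeq X a ω) A * κ (tailSeq X b ω) A ∂P).toReal := fun a b => by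
    rw [integral_eq_lintegral_of_nonneg_ae
      (ae_of_all _ fun ω => mul_nonneg (hg0 a ω) (hg0 b ω)) (hint a b).1]
    congr 1
    refine lintegral_congr fun ω => ?_
    simp [hg, ENNReal.ofReal_mul]
  -- Both sides are the integral of `1_A (X 0)` against a function of the later tail.
  have hcross : ∫ ω, g n ω * g (n + 1) ω ∂P = ∫ ω, g (n + 1) ω * g (n + 1) ω ∂P := by
    rw [hl, hl]
    congr 1
    rw [← h.lintegral_indicator_mul hX (Nat.succ_pos n) hA hκ]
    simp_rw [tailSeq_succ]
    exact (h.lintegral_indicator_mul hX hn hA (measurable_comp_shift hκ)).symm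
  have hsame : ∫ ω, g n ω * g n ω ∂P = ∫ ω, g (n + 1) ω * g (n + 1) ω ∂P := by
    rw [hl, hl]
    congr 1
    have : ∀ m, ∫⁻ ω, κ (tailSeq X m ω) A * κ (tailSeq X m ω) A ∂P =
        ∫⁻ y, κ y A * κ y A ∂P.map (tailSeq X 1) := fun m => by
      rw [← h.map_tailSeq hX m, lintegral_map (f := fun y => κ y A * κ y A)
        (hκ.mul hκ) (measurable_tailSeq hX m)]
    rw [this, this]
  have hzero : ∫ ω, (g n ω - g (n + 1) ω) ^ 2 ∂P = 0 := by
    have : ∀ ω, (g n ω - g (n + 1) ω) ^ 2 =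
        g n ω * g n ω - g n ω * g (n + 1) ω - (g n ω * g (n + 1) ω - g (n + 1) ω * g (n + 1) ω) :=
      fun ω => by ring
    simp_rw [this]
    rw [integral_sub (f := fun ω => g n ω * g n ω - g n ω * g (n + 1) ω)
        (g := fun ω => g n ω * g (n + 1) ω - g (n + 1) ω * g (n + 1) ω)
        ((hint _ _).sub (hint _ _)) ((hint _ _).sub (hint _ _)),
      integral_sub (hint _ _) (hint _ _), integral_sub (hint _ _) (hint _ _), hcross, hsame]
    ring
  have hi : Integrable (fun ω => (g n ω - g (n + 1) ω) ^ 2) P :=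
    Integrable.of_bound (((hgm n).sub (hgm (n + 1))).pow_const 2).aestronglyMeasurable 1 <|
      ae_of_all _ fun ω => by
        rw [Real.norm_of_nonneg (sq_nonneg _), sq_le_one_iff_abs_le_one, abs_le]
        constructor <;> linarith [hg0 n ω, hg0 (n + 1) ω, hg1 n ω, hg1 (n + 1) ω]
  filter_upwards [(integral_eq_zero_iff_of_nonneg (fun ω => sq_nonneg _) hi).1 hzero] with ω hω
  have : g n ω = g (n + 1) ω := sub_eq_zero.1 (pow_eq_zero_iff two_ne_zero |>.1 hω)
  exact (measureReal_eq_measureReal_iff).1 this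

/-- Conditionally on the `k`-th tail, `X 0, …, X (k - 1)` are independent with the directing random
measure as common law. -/
theorem IsExchangeable.lintegral_prod_indicator_mul (h : IsExchangeable P X)
    (hX : ∀ i, Measurable (X i)) {A : ℕ → Set ℝ} (hA : ∀ i, MeasurableSet (A i)) (k : ℕ)
    {H : (ℕ → ℝ) → ℝ≥0∞} (hH : Measurable H) :
    ∫⁻ ω, (∏ i ∈ Finset.range k, (A i).indicator 1 (X i ω)) * H (tailSeq X k ω) ∂P =
      ∫⁻ ω, (∏ i ∈ Finset.range k, directingKernel P X (tailSeq X k ω) (A i)) *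
        H (tailSeq X k ω) ∂P := by
  set κ := directingKernel P X
  have hκ : ∀ i, Measurable fun y => κ y (A i) := fun i => Kernel.measurable_coe _ (hA i)
  induction k generalizing H with
  | zero => simp
  | succ k ih =>
    -- `1_{A k} (X k) * H (tail (k + 1))` is a function of the `k`-th tail.
    have hH' : Measurable fun y : ℕ → ℝ =>
        (A k).indicator (1 : ℝ → ℝ≥0∞) (y 0) * H fun j => y (j + 1) :=
      ((measurable_one.indicator (hA k)).comp (measurable_pi_apply 0)).mul
        (measurable_comp_shift hH)
    calc ∫⁻ ω, (∏ i ∈ Finset.range (k + 1), (A i).indicator 1 (X i ω)) * H (tailSeq X (k + 1) ω) ∂P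
        = ∫⁻ ω, (∏ i ∈ Finset.range k, (A i).indicator 1 (X i ω)) *
            ((A k).indicator 1 (tailSeq X k ω 0) * H fun j => tailSeq X k ω (j + 1)) ∂P :=
          lintegral_congr fun ω => by
            rw [Finset.prod_range_succ, mul_assoc, tailSeq_succ]; rfl
      _ = ∫⁻ ω, (∏ i ∈ Finset.range k, κ (tailSeq X k ω) (A i)) *
            ((A k).indicator 1 (tailSeq X k ω 0) * H fun j => tailSeq X k ω (j + 1)) ∂P := ih hH'
      _ = ∫⁻ ω, (A k).indicator 1 (X k ω) * ((∏ i ∈ Finset.range k,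
            κ (tailSeq X (k + 1) ω) (A i)) * H (tailSeq X (k + 1) ω)) ∂P := by
          rcases Nat.eq_zero_or_pos k with rfl | hk
          · simp [tailSeq_succ, tailSeq]
          refine lintegral_congr_ae ?_
          have hae : ∀ᵐ ω ∂P, ∀ i, κ (tailSeq X k ω) (A i) = κ (tailSeq X (k + 1) ω) (A i) :=
            ae_all_iff.2 fun i => h.directingKernel_tailSeq_succ hX hk (hA i)
          filter_upwards [hae] with ω hω
          simp_rw [hω, ← tailSeq_succ]
          rw [mul_left_comm]; rfl
      _ = ∫⁻ ω, κ (tailSeq X (k + 1) ω) (A k) * ((∏ i ∈ Finset.range k,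
            κ (tailSeq X (k + 1) ω) (A i)) * H (tailSeq X (k + 1) ω)) ∂P :=
          h.lintegral_indicator_mul hX (Nat.lt_succ_self k) (hA k)
            (H := fun y => (∏ i ∈ Finset.range k, κ y (A i)) * H y)
            ((Finset.measurable_prod _ fun i _ => hκ i).mul hH)
      _ = _ := lintegral_congr fun ω => by
          rw [Finset.prod_range_succ, ← mul_assoc, mul_comm (κ _ (A k))]

end DeFinetti

/-! ### The kernel of i.i.d. samples -/

namespace DistributionFunction

/-- The distribution function of a probability measure. On other measures it takes the junk
values of `cdf`. -/
noncomputable def ofMeasure (ν : Measure ℝ) : DistributionFunction where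
  toStieltjesFunction := cdf ν
  tendsto_atBot' := tendsto_cdf_atBot ν
  tendsto_atTop' := tendsto_cdf_atTop ν

theorem law_ofMeasure (ν : Measure ℝ) [IsProbabilityMeasure ν] : (ofMeasure ν).law = ν :=
  measure_cdf ν

theorem measurable_ofMeasure_kernel {α : Type*} [MeasurableSpace α] (κ : Kernel α ℝ)
    [IsMarkovKernel κ] : Measurable fun a => ofMeasure (κ a) := by
  refine measurable_generateFrom ?_
  rintro _ ⟨x, y, rfl⟩
  have h : ∀ a, (ofMeasure (κ a)).toStieltjesFunction x = (κ a).real (Set.Iic x) :=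
    fun a => cdf_eq_real _ x
  simp only [Set.preimage_ofPred_eq, h]
  exact measurableSet_le (Kernel.measurable_coe κ measurableSet_Iic).ennreal_toReal
    measurable_const

theorem measurable_pi_law (n : ℕ) :
    Measurable fun F : DistributionFunction => Measure.pi fun _ : Fin n => F.law := by
  refine .measure_of_isPiSystem_of_isProbabilityMeasure generateFrom_pi.symm isPiSystem_pi ?_
  rintro _ ⟨s, hs, rfl⟩
  have hs : ∀ i, MeasurableSet (s i) := fun i => hs i (Set.mem_univ i)
  simp_rw [Measure.pi_pi]
  exact Finset.measurable_prod _ fun i _ => (Measure.measurable_coe (hs i)).comp measurable_law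

/-- The kernel sending `F` to the law of `n` independent variables with distribution function
`F`. -/
noncomputable def iidKernel (n : ℕ) : Kernel DistributionFunction (Fin n → ℝ) where
  toFun F := Measure.pi fun _ => F.law
  measurable' := measurable_pi_law n

theorem iidKernel_apply (n : ℕ) (F : DistributionFunction) :
    iidKernel n F = Measure.pi fun _ => F.law := rfl

instance (n : ℕ) : IsMarkovKernel (iidKernel n) :=
  ⟨fun F => by rw [iidKernel_apply]; infer_instance⟩

end DistributionFunction

open DistributionFunction

/-- The mixing property, as an identity between measures on `Fin n → ℝ`. -/
theorem isMixingMeasure_iff {Ω : Type*} [MeasurableSpace Ω] {P : Measure Ω}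
    {X : ℕ → Ω → ℝ} (hX : ∀ i, Measurable (X i)) {μ : Measure DistributionFunction} :
    IsMixingMeasure P X μ ↔
      ∀ n : ℕ, 0 < n → P.map (fun ω (i : Fin n) => X i ω) = iidKernel n ∘ₘ μ := by
  have hm : ∀ n : ℕ, Measurable fun ω (i : Fin n) => X i ω := fun n =>
    measurable_pi_lambda _ fun i => hX i
  refine forall₂_congr fun n _ => ⟨fun h => Measure.ext fun B hB => ?_, fun h B hB => ?_⟩
  · rw [Measure.map_apply (hm n) hB, Measure.bind_apply hB (Kernel.aemeasurable _)]
    exact h B hB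
  · have := congrArg (fun ν : Measure (Fin n → ℝ) => ν B) h
    rwa [Measure.map_apply (hm n) hB, Measure.bind_apply hB (Kernel.aemeasurable _)] at this

/-- **De Finetti's theorem** for real sequences. -/
theorem IsExchangeable.exists_isMixingMeasure {Ω : Type*} [MeasurableSpace Ω] {P : Measure Ω}
    [IsProbabilityMeasure P] {X : ℕ → Ω → ℝ} (h : IsExchangeable P X)
    (hX : ∀ i, Measurable (X i)) :
    ∃ μ : Measure DistributionFunction, IsProbabilityMeasure μ ∧ IsMixingMeasure P X μ := by
  set κ := directingKernel P X
  have hΦ := measurable_ofMeasure_kernel κ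
  have ht := measurable_tailSeq hX 1
  have hp : IsProbabilityMeasure (P.map (tailSeq X 1)) :=
    Measure.isProbabilityMeasure_map ht.aemeasurable
  have hμ : IsProbabilityMeasure ((P.map (tailSeq X 1)).map fun y => ofMeasure (κ y)) :=
    Measure.isProbabilityMeasure_map hΦ.aemeasurable
  refine ⟨_, hμ, (isMixingMeasure_iff hX).2 fun n _ => ?_⟩
  have hm : Measurable fun ω (i : Fin n) => X i ω := measurable_pi_lambda _ fun i => hX i
  have : IsProbabilityMeasure (P.map fun ω (i : Fin n) => X i ω) :=
    Measure.isProbabilityMeasure_map hm.aemeasurable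
  refine ext_of_generate_finite _ generateFrom_pi.symm isPiSystem_pi ?_ (by simp)
  rintro _ ⟨s, hs, rfl⟩
  have hs : ∀ i, MeasurableSet (s i) := fun i => hs i (Set.mem_univ i)
  -- Extend the finite family of sides to a sequence.
  let A : ℕ → Set ℝ := fun i => if hi : i < n then s ⟨i, hi⟩ else Set.univ
  have hA : ∀ i, MeasurableSet (A i) := fun i => by
    by_cases hi : i < n
    · simpa [A, hi] using hs _
    · simp [A, hi]
  have hAs : ∀ i : Fin n, A i = s i := fun i => by simp [A]
  have hbox := MeasurableSet.univ_pi hs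
  have hκ : Measurable fun y => ∏ i ∈ Finset.range n, κ y (A i) :=
    Finset.measurable_prod _ fun i _ => Kernel.measurable_coe _ (hA i)
  calc P.map (fun ω (i : Fin n) => X i ω) (Set.univ.pi s)
      = ∫⁻ ω, (∏ i ∈ Finset.range n, (A i).indicator 1 (X i ω)) * 1 ∂P := by
        rw [Measure.map_apply hm hbox, ← lintegral_indicator_one (hm hbox)]
        refine lintegral_congr fun ω => ?_
        rw [mul_one, Finset.prod_range]
        classical
        simp [hAs, Set.indicator_apply, Finset.prod_ite_zero]
    _ = ∫⁻ ω, ∏ i ∈ Finset.range n, κ (tailSeq X n ω) (A i) ∂P := by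
        rw [h.lintegral_prod_indicator_mul hX hA n (H := fun _ => 1) measurable_const]
        simp [κ]
    _ = ∫⁻ y, ∏ i ∈ Finset.range n, κ y (A i) ∂P.map (tailSeq X 1) := by
        rw [← h.map_tailSeq hX n, lintegral_map hκ (measurable_tailSeq hX n)]
    _ = (iidKernel n ∘ₘ (P.map (tailSeq X 1)).map fun y => ofMeasure (κ y)) (Set.univ.pi s) := by
        rw [Measure.bind_apply hbox (Kernel.aemeasurable _),
          lintegral_map (Kernel.measurable_coe _ hbox) hΦ]
        refine lintegral_congr fun y => ?_
        rw [iidKernel_apply, Measure.pi_pi, law_ofMeasure, Finset.prod_range]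
        simp_rw [hAs]

/-! ### Moments and sums under a mixture -/

/-- Fubini for a mixture: both the integrability of the inner integral and the iterated formula. -/
theorem integral_bind_kernel {α β E : Type*} [MeasurableSpace α] [MeasurableSpace β]
    [NormedAddCommGroup E] [NormedSpace ℝ E] {μ : Measure α} {κ : Kernel α β} {f : β → E}
    (hf : Integrable f (κ ∘ₘ μ)) :
    Integrable (fun a => ∫ b, f b ∂κ a) μ ∧ ∫ b, f b ∂(κ ∘ₘ μ) = ∫ a, ∫ b, f b ∂κ a ∂μ := by
  rw [Measure.comp_eq_comp_const_apply] at hf ⊢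
  exact ⟨by simpa using hf.integral_comp, by simpa using Kernel.integral_comp hf⟩

namespace DistributionFunction

theorem integrable_eval_iidKernel_iff {n : ℕ} {F : DistributionFunction} {f : ℝ → ℝ}
    (hf : Measurable f) (i : Fin n) :
    Integrable (fun x => f (x i)) (iidKernel n F) ↔ Integrable f F.law :=
  (measurePreserving_eval (fun _ : Fin n => F.law) i).integrable_comp hf.aestronglyMeasurable

theorem secondMoment_lt_top_iff (F : DistributionFunction) :
    F.secondMoment < ∞ ↔ Integrable (fun x : ℝ => x ^ 2) F.law := by
  rw [secondMoment, ← hasFiniteIntegral_iff_ofReal (ae_of_all _ fun x => sq_nonneg x)]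
  exact ⟨fun h => ⟨by fun_prop, h⟩, fun h => h.2⟩

/-- The characteristic function of the normalized sum of `n` independent variables with distribution
function `F`. -/
theorem integral_cexp_iidKernel (n : ℕ) (s : ℝ) (F : DistributionFunction) :
    ∫ x, Complex.exp ((s * ∑ i, x i : ℝ) * Complex.I) ∂iidKernel n F = charFun F.law s ^ n := by
  have h : ∀ x : Fin n → ℝ, Complex.exp ((s * ∑ i, x i : ℝ) * Complex.I) =
      ∏ i, Complex.exp (s * x i * Complex.I) := fun x => by
    rw [← Complex.exp_sum, Finset.mul_sum, Complex.ofReal_sum, Finset.sum_mul]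
    simp
  simp_rw [h]
  rw [iidKernel_apply, integral_fintype_prod_eq_pow (fun y : ℝ => Complex.exp (s * y * Complex.I)),
    charFun_apply_real, Fintype.card_fin]

/-- The central limit theorem for a centered distribution function, in terms of characteristic
functions. The degenerate case `E[X_F ^ 2] = 0` is included. -/
theorem tendsto_charFun_pow {F : DistributionFunction} (hF : F ∈ centered) (t : ℝ) :
    Tendsto (fun n : ℕ => charFun F.law ((√(n : ℝ))⁻¹ * t) ^ n) atTop
      (𝓝 (charFun (gaussianReal 0 F.secondMoment.toNNReal) t)) := by
  obtain ⟨Ω, _, P, Y, hY, hlaw, hindep, hP⟩ := exists_iid ℕ F.law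
  have hident : ∀ i, IdentDistrib (Y i) (Y 0) P P := fun i =>
    ⟨(hY i).aemeasurable, (hY 0).aemeasurable, by rw [(hlaw i).map_eq, (hlaw 0).map_eq]⟩
  have h2 : MemLp (fun x : ℝ => x) 2 F.law :=
    (memLp_two_iff_integrable_sq (by fun_prop)).2 ((secondMoment_lt_top_iff F).1 hF.2)
  have hL2 : MemLp (Y 0) 2 P := by
    rw [← (hlaw 0).map_eq] at h2
    exact h2.comp_of_map (hY 0).aemeasurable
  have hmean : ∫ ω, Y 0 ω ∂P = 0 := by
    rw [← hF.1, ← (hlaw 0).map_eq, integral_map (hY 0).aemeasurable (by fun_prop)]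
  have hvar : Var[Y 0; P].toNNReal = F.secondMoment.toNNReal := by
    rw [variance_eq_integral (hY 0).aemeasurable, hmean]
    simp only [sub_zero]
    rw [← integral_map (φ := Y 0) (f := fun x => x ^ 2) (hY 0).aemeasurable (by fun_prop),
      (hlaw 0).map_eq, integral_eq_lintegral_of_nonneg_ae (ae_of_all _ fun x => sq_nonneg x)
        (by fun_prop)]
    exact Real.toNNReal_coe
  have hclt := tendstoInDistribution_inv_sqrt_mul_sum_sub (Y := id)
    (P' := gaussianReal 0 Var[Y 0; P].toNNReal) .id hL2 hindep hident
  have h := ProbabilityMeasure.tendsto_iff_tendsto_charFun.1 hclt.tendsto t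
  simp only [hmean, mul_zero, sub_zero, hvar, Measure.map_id] at h
  simpa [charFun_inv_sqrt_mul_sum hindep hident, (hlaw 0).map_eq] using h

end DistributionFunction

/-! ### The Gaussian mixture limit -/

section Mixture

variable {Ω : Type*} [MeasurableSpace Ω] {P : Measure Ω}
  {X : ℕ → Ω → ℝ} {μ : Measure DistributionFunction}

/-- Uncorrelatedness passes to the mixing measure: `E[X 0 * X 1]` is the `μ`-integral of the squared
mean `E[X_F] ^ 2`, so it vanishes only if almost every `F` has mean zero. -/
theorem IsMixingMeasure.ae_mem_centered [IsProbabilityMeasure P] (h : IsMixingMeasure P X μ)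
    (hX : ∀ i, Measurable (X i)) (hcov : ∫ ω, X 0 ω * X 1 ω ∂P = 0)
    (hsq : Integrable (fun ω => X 0 ω ^ 2) P) (hsq' : Integrable (fun ω => X 1 ω ^ 2) P) :
    ∀ᵐ F ∂μ, F ∈ centered := by
  have hm : Measurable fun ω (i : Fin 2) => X i ω := measurable_pi_lambda _ fun i => hX i
  have hlaw := (isMixingMeasure_iff hX).1 h 2 two_pos
  have hint : Integrable (fun x : Fin 2 → ℝ => x 0 * x 1) (iidKernel 2 ∘ₘ μ) := by
    rw [← hlaw, integrable_map_measure (by fun_prop) hm.aemeasurable]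
    exact ((memLp_two_iff_integrable_sq (hX 0).aestronglyMeasurable).2 hsq).integrable_mul
      ((memLp_two_iff_integrable_sq (hX 1).aestronglyMeasurable).2 hsq')
  have hint2 : Integrable (fun x : Fin 2 → ℝ => x 0 ^ 2) (iidKernel 2 ∘ₘ μ) := by
    have hmeas : Measurable fun x : Fin 2 → ℝ => x 0 ^ 2 := by fun_prop
    rw [← hlaw, integrable_map_measure hmeas.aestronglyMeasurable hm.aemeasurable]
    exact hsq
  have hfubini : ∀ F : DistributionFunction,
      ∫ x, x 0 * x 1 ∂iidKernel 2 F = (∫ x, x ∂F.law) ^ 2 := fun F => by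
    rw [iidKernel_apply]
    simpa [Fin.prod_univ_two] using
      integral_fintype_prod_eq_pow (ι := Fin 2) (μ := F.law) fun x : ℝ => x
  have hzero : ∫ F, (∫ x, x ∂F.law) ^ 2 ∂μ = 0 := by
    simp_rw [← hfubini]
    rw [← (integral_bind_kernel hint).2, ← hlaw, integral_map hm.aemeasurable (by fun_prop)]
    exact hcov
  have hi := (integral_bind_kernel hint).1
  simp_rw [hfubini] at hi
  filter_upwards [(integral_eq_zero_iff_of_nonneg (fun F => sq_nonneg _) hi).1 hzero,
    Measure.ae_integrable_of_integrable_comp hint2] with F hF hF2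
  refine ⟨pow_eq_zero_iff two_ne_zero |>.1 hF, (secondMoment_lt_top_iff F).2 ?_⟩
  exact (integrable_eval_iidKernel_iff (f := fun x => x ^ 2) (by fun_prop) (0 : Fin 2)).1 hF2

/-- The characteristic function of `S_n` is the mixture of those of the i.i.d. sums. -/
theorem IsMixingMeasure.charFun_map_sum [IsProbabilityMeasure μ] (h : IsMixingMeasure P X μ)
    (hX : ∀ i, Measurable (X i)) {n : ℕ} (hn : 0 < n) (c t : ℝ) :
    charFun (P.map fun ω => c * ∑ i ∈ Finset.range n, X i ω) t =
      ∫ F, charFun F.law (c * t) ^ n ∂μ := by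
  have hlaw := (isMixingMeasure_iff hX).1 h n hn
  have hm : Measurable fun ω (i : Fin n) => X i ω := measurable_pi_lambda _ fun i => hX i
  set f : (Fin n → ℝ) → ℂ := fun x => Complex.exp ((c * t * ∑ i, x i : ℝ) * Complex.I) with hf
  have hfm : Measurable f := by fun_prop
  have hfi : Integrable f (iidKernel n ∘ₘ μ) :=
    Integrable.of_bound hfm.aestronglyMeasurable 1 <| ae_of_all _ fun x => by
      simp only [hf]
      rw [Complex.norm_exp_ofReal_mul_I]
  have hS : Measurable fun ω => c * ∑ i ∈ Finset.range n, X i ω :=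
    (Finset.measurable_sum _ fun i _ => hX i).const_mul c
  simp_rw [← integral_cexp_iidKernel]
  rw [← (integral_bind_kernel hfi).2, ← hlaw, integral_map hm.aemeasurable hfm.aestronglyMeasurable,
    charFun_apply_real, integral_map hS.aemeasurable (by fun_prop)]
  refine integral_congr_ae (ae_of_all _ fun ω => ?_)
  simp only [hf, Finset.sum_range]
  congr 2
  push_cast
  ring

theorem charFun_centeredGaussianMixture [IsProbabilityMeasure μ] (h : ∀ᵐ F ∂μ, F ∈ centered)
    (t : ℝ) : charFun (centeredGaussianMixture μ) t =
      ∫ F, charFun (gaussianReal 0 F.secondMoment.toNNReal) t ∂μ := by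
  let κ : Kernel DistributionFunction ℝ :=
    ⟨fun F => gaussianReal 0 F.secondMoment.toNNReal, measurable_gaussianReal_secondMoment⟩
  have : IsMarkovKernel κ := 
    ⟨fun F => inferInstanceAs (IsProbabilityMeasure (gaussianReal 0 _))⟩
  have hbind : centeredGaussianMixture μ = κ ∘ₘ μ := by
    rw [centeredGaussianMixture, Measure.restrict_eq_self_of_ae_mem h]; rfl
  simp_rw [charFun_apply_real]
  rw [hbind, (integral_bind_kernel _).2]
  · rfl
  · refine Integrable.of_bound (by fun_prop) 1 (ae_of_all _ fun x => ?_)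
    rw [← Complex.ofReal_mul, Complex.norm_exp_ofReal_mul_I]

theorem isProbabilityMeasure_centeredGaussianMixture [IsProbabilityMeasure μ]
    (h : ∀ᵐ F ∂μ, F ∈ centered) : IsProbabilityMeasure (centeredGaussianMixture μ) := by
  rw [isProbabilityMeasure_iff, centeredGaussianMixture_apply μ MeasurableSet.univ,
    Measure.restrict_eq_self_of_ae_mem h]
  simp

/-- Mixing the central limit theorem over `μ`, by dominated convergence. -/
theorem IsMixingMeasure.tendsto_charFun [IsProbabilityMeasure μ] (h : IsMixingMeasure P X μ)
    (hX : ∀ i, Measurable (X i)) (hc : ∀ᵐ F ∂μ, F ∈ centered) (t : ℝ) :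
    Tendsto (fun n : ℕ => charFun (P.map fun ω => 1 / √(n : ℝ) * ∑ i ∈ Finset.range n, X i ω) t)
      atTop (𝓝 (charFun (centeredGaussianMixture μ) t)) := by
  rw [charFun_centeredGaussianMixture hc]
  have hlim : Tendsto (fun n : ℕ => ∫ F, charFun F.law ((√(n : ℝ))⁻¹ * t) ^ n ∂μ) atTop
      (𝓝 (∫ F, charFun (gaussianReal 0 F.secondMoment.toNNReal) t ∂μ)) := by
    refine tendsto_integral_of_dominated_convergence (fun _ => 1) (fun n => ?_)
      (integrable_const 1) (fun n => ae_of_all _ fun F => ?_)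
      (hc.mono fun F hF => tendsto_charFun_pow hF t)
    · simp_rw [← integral_cexp_iidKernel]
      exact (StronglyMeasurable.integral_kernel
        (f := fun x : Fin n → ℝ => Complex.exp (((√(n : ℝ))⁻¹ * t * ∑ i, x i : ℝ) * Complex.I))
        (Measurable.stronglyMeasurable (by fun_prop))).aestronglyMeasurable
    · rw [norm_pow]
      exact pow_le_one₀ (norm_nonneg _) (norm_charFun_le_one _)
  refine hlim.congr' ?_
  filter_upwards [eventually_gt_atTop 0] with n hn
  rw [h.charFun_map_sum hX hn, one_div]

end Mixture

theorem theorem3p9 {Ω : Type*} [MeasurableSpace Ω] (P : Measure Ω) [IsProbabilityMeasure P]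
    (X : ℕ → Ω → ℝ) (hX : ∀ i, Measurable (X i)) (hexch : IsExchangeable P X)
    (hmean : ∫ ω, X 0 ω ∂P = 0) (hcov : ∫ ω, X 0 ω * X 1 ω ∂P = 0)
    (hsq : Integrable (fun ω => X 0 ω ^ 2) P) :
    (∃ μ : Measure DistributionFunction, IsProbabilityMeasure μ ∧ IsMixingMeasure P X μ) ∧
    ∀ μ : Measure DistributionFunction, IsProbabilityMeasure μ → IsMixingMeasure P X μ →
      IsProbabilityMeasure (centeredGaussianMixture μ) ∧
      ∀ {Ω' : Type*} [MeasurableSpace Ω'] (P' : Measure Ω') [IsProbabilityMeasure P']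
        (Z : Ω' → ℝ), HasLaw Z (centeredGaussianMixture μ) P' →
        TendstoInDistribution
          (fun (n : ℕ) ω => (1 / √(n : ℝ)) * ∑ i ∈ Finset.range n, X i ω) atTop Z
          (fun _ => P) P' := by
  refine ⟨hexch.exists_isMixingMeasure hX, fun μ hμ hmix => ?_⟩
  have hident : IdentDistrib (X 1) (X 0) P P := by
    have h := hexch.map_tailSeq_prodMk hX (i := 1) (n := 2) (by norm_num)
    have h' := congrArg (Measure.map Prod.snd) h
    rw [Measure.map_map measurable_snd ((measurable_tailSeq hX 2).prodMk (hX 1)),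
      Measure.map_map measurable_snd ((measurable_tailSeq hX 1).prodMk (hX 0))] at h'
    exact ⟨(hX 1).aemeasurable, (hX 0).aemeasurable, h'⟩
  have hsq' : Integrable (fun ω => X 1 ω ^ 2) P :=
    (hident.comp (u := fun x => x ^ 2) (by fun_prop)).integrable_iff.2 hsq
  have hc := hmix.ae_mem_centered hX hcov hsq hsq'
  refine ⟨isProbabilityMeasure_centeredGaussianMixture hc, fun P' _ Z hZ => ⟨fun n => ?_,
    hZ.aemeasurable, ?_⟩⟩
  · exact ((Finset.measurable_sum _ fun i _ => hX i).const_mul _).aemeasurable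
  · refine ProbabilityMeasure.tendsto_iff_tendsto_charFun.2 fun t => ?_
    simpa [hZ.map_eq] using hmix.tendsto_charFun hX hc t
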